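/- Let $N\ge 1$ and $\lambda\in[0,1]$. On $(\mathbb C^2)^{\otimes N}$ with basis $|\mathbf n\rangle$, $\mathbf n\in\{0,1\}^N$, $|\mathbf n|=\sum_l n_l$, let $C[\lambda]$ be the coherence matrix of the $N$-qubit spin-boson model, with entries $\lambda^{(|\mathbf n|-|\mathbf m|)^2}$ (and $0^0=1$). An observable is a finite family of positive semidefinite matrices with sum $\mathbb 1$; two observables $\mathsf M,\mathsf F$ are jointly measurable if there is an observable $(\mathsf G(i,j))_{i,j}$ with $\sum_j\mathsf G(i,j)=\mathsf M(i)$ and $\sum_i\mathsf G(i,j)=\mathsf F(j)$ for all $i,j$. Let $\mathcal C_{C[\lambda]}$ be the set of observables $\mathsf P$, with all effects $\mathsf P(j)$ diagonal, such that $\mathsf P$ is jointly measurable with $(C[\lambda]*\mathsf Q(i))_i$ (entrywise product) for every observable $\mathsf Q$. For $j=0,\dots,N$ let $\mathsf P^C(j)$ be the projector onto $\mathrm{span}\{|\mathbf n\rangle : |\mathbf n|=j\}$ (the spectral resolution of the system Hamiltonian $\omega_0S_z$), and for $\alpha\in[0,1]$ put $\mathsf P^C_\alpha(j)=\alpha\,\mathsf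 P^C(j)+(1-\alpha)\,2^{-N}\mathrm{tr}[\mathsf P^C(j)]\,\mathbb 1$. Define $$\alpha_N(\lambda)=\max\{\alpha\in[0,1] : \mathsf P^C_\alpha\in\mathcal C_{C[\lambda]}\}.$$ With $c_N(k)=\binom Nk 2^{-N}$, let $$u_k(\alpha)=\sqrt{c_N(k)(1-\alpha)\bigl(\alpha+c_N(k)(1-\alpha)\bigr)}-c_N(k)(1-\alpha),\qquad \beta_{kk'}(\alpha)=1-\alpha+u_k(\alpha)+u_{k'}(\alpha),$$ let $\vartheta_3(x,\lambda)=1+2\sum_{k\ge1}\lambda^{k^2}\cos(2kx)$ for $0\le\lambda<1$, and let $\vartheta_3(\tfrac\pi2,1)=\lim_{\lambda\uparrow1}\vartheta_3(\tfrac\pi2,\lambda)$. Then the maximum defining $\alpha_N(\lambda)$ and the limit defining $\vartheta_3(\tfrac\pi2,1)$ exist, $\vartheta_3(\tfrac\pi2,\lambda)\in[0,1]$, the functions $\beta_{01}$ and $\beta_{00}$ are strictly decreasing bijections of $[0,1]$ onto $[0,1]$, and with $$U_N(\lambda)=[\beta_{01}]^{-1}(\lambda),\qquad L_N(\lambda)=[\beta_{00}]^{-1}\bigl(1-\vartheta_3(\tfrac\pi2,\lambda)\bigr)$$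 one has $$\vartheta_3(\tfrac\pi2,\lambda)\le L_N(\lambda)\le\alpha_N(\lambda)\le U_N(\lambda)\qquad\text{for all }N=1,2,\dots\text{ and }\lambda\in[0,1].$$ The lower bound $\vartheta_3(\tfrac\pi2,\lambda)$ does not depend on $N$. -/

import Mathlib

open scoped Matrix ComplexOrder

noncomputable section

namespace SpinBoson

/-- A finite-outcome observable (POVM): positive semidefinite effects summing to the identity. -/
def IsObservable {ι Ω : Type} [Fintype ι] [DecidableEq ι] [Fintype Ω]
    (M : Ω → Matrix ι ι ℂ) : Prop :=
  (∀ i, (M i).PosSemidef) ∧ ∑ i, M i = 1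

/-- An observable is incoherent if all its effects are diagonal in the incoherent basis. -/
def IsIncoherent {ι Ω : Type} (P : Ω → Matrix ι ι ℂ) : Prop :=
  ∀ j, (P j).IsDiag

/-- `M` and `F` are jointly measurable: they are the two marginals of a joint observable. -/
def JointlyMeasurable {ι Ω₁ Ω₂ : Type} [Fintype ι] [DecidableEq ι] [Fintype Ω₁] [Fintype Ω₂]
    (M : Ω₁ → Matrix ι ι ℂ) (F : Ω₂ → Matrix ι ι ℂ) : Prop :=
  ∃ G : Ω₁ × Ω₂ → Matrix ι ι ℂ, IsObservable G ∧
    (∀ i, ∑ j, G (i, j) = M i) ∧ (∀ j, ∑ i, G (i, j) = F j)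

/-- For a coherence matrix `C`, the set of incoherent observables (with outcome set `Ω`) that are
jointly measurable with the entrywise product `C ⊙ Q` for every finite-outcome observable `Q`. -/
def compatibleSet {ι : Type} [Fintype ι] [DecidableEq ι] (C : Matrix ι ι ℂ)
    (Ω : Type) [Fintype Ω] : Set (Ω → Matrix ι ι ℂ) :=
  {P | IsObservable P ∧ IsIncoherent P ∧
    ∀ (Ω' : Type) [Fintype Ω'] (Q : Ω' → Matrix ι ι ℂ), IsObservable Q →
      JointlyMeasurable (fun i => C ⊙ Q i) P}

/-- Labels `𝐧 = (n₁, …, n_N)`, `n_l ∈ {0, 1}`, of the `σ_z` basis of `N` qubits. -/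
abbrev QubitLabel (N : ℕ) : Type := Fin N → Fin 2

/-- `|𝐧| = ∑ n_l`. -/
def weight {N : ℕ} (n : QubitLabel N) : ℕ := ∑ l, (n l : ℕ)

/-- The spin-boson coherence matrix `C[t]`, with entries `t ^ ((|𝐧| - |𝐦|)²)`. -/
def coherenceMatrix (N : ℕ) (t : ℝ) : Matrix (QubitLabel N) (QubitLabel N) ℂ :=
  Matrix.of fun n m => ((t ^ (((weight n : ℤ) - (weight m : ℤ)).natAbs ^ 2) : ℝ) : ℂ)

/-- The spectral resolution of the system Hamiltonian `ω₀ S_z`: the `j`-th effect is the projector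
onto `span {|𝐧⟩ : |𝐧| = j}`, an eigenspace of the total spin `S_z`. -/
def spectralObservable (N : ℕ) (j : Fin (N + 1)) : Matrix (QubitLabel N) (QubitLabel N) ℂ :=
  Matrix.diagonal fun n => if weight n = (j : ℕ) then 1 else 0

/-- The depolarisation `2^(-N) tr[P(j)] 𝟙` of the spectral resolution. -/
def depolarisedObservable (N : ℕ) (j : Fin (N + 1)) :
    Matrix (QubitLabel N) (QubitLabel N) ℂ :=
  ((1 / 2 ^ N : ℂ) * (spectralObservable N j).trace) • 1

/-- The mixture `a P + (1 - a) P_dep` of the spectral resolution with its depolarisation. -/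
def mixedObservable (N : ℕ) (a : ℝ) (j : Fin (N + 1)) :
    Matrix (QubitLabel N) (QubitLabel N) ℂ :=
  (a : ℂ) • spectralObservable N j + ((1 - a : ℝ) : ℂ) • depolarisedObservable N j

/-- The mixing parameters `a ∈ [0, 1]` at which the mixture has no incompatibility due to the
coherence `C[t]`. -/
def compatibleMixing (N : ℕ) (t : ℝ) : Set ℝ :=
  {a | a ∈ Set.Icc (0 : ℝ) 1 ∧
    mixedObservable N a ∈ compatibleSet (coherenceMatrix N t) (Fin (N + 1))}

/-- The critical mixing parameter `α_N(t)`. -/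
def critical (N : ℕ) (t : ℝ) : ℝ := sSup (compatibleMixing N t)

/-- The binomial (coin toss) distribution `c_N(k)`. -/
def coin (N k : ℕ) : ℝ := (N.choose k : ℝ) / 2 ^ N

/-- `u_k(a) = √(c_N(k)(1-a)(a + c_N(k)(1-a))) - c_N(k)(1-a)`. -/
def u (N k : ℕ) (a : ℝ) : ℝ :=
  √(coin N k * (1 - a) * (a + coin N k * (1 - a))) - coin N k * (1 - a)

/-- `β_{k k'}(a) = 1 - a + u_k(a) + u_{k'}(a)`. -/
def beta (N k k' : ℕ) (a : ℝ) : ℝ := 1 - a + u N k a + u N k' a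

/-- The series `1 + 2 ∑_{k ≥ 1} q^(k²) cos (2 k x)`, which converges for `|q| < 1`. -/
def theta3Series (x q : ℝ) : ℝ :=
  1 + 2 * ∑' k : ℕ, q ^ ((k + 1) ^ 2) * Real.cos (2 * ((k : ℝ) + 1) * x)

/-- The Jacobi theta function `ϑ₃(x, q)` for `q ∈ [0, 1]`: the sum of its series for `q < 1`, and
the left limit of these sums at `q = 1`, where the series diverges. -/
def theta3 (x q : ℝ) : ℝ :=
  if q < 1 then theta3Series x q else Filter.limUnder (nhdsWithin 1 (Set.Iio 1)) (theta3Series x)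

/-- `U_N = β₀₁⁻¹`, the inverse of `β₀₁` as a function on `[0, 1]`. -/
def upperBound (N : ℕ) (t : ℝ) : ℝ :=
  Function.invFunOn (beta N 0 1) (Set.Icc 0 1) t

/-- `L_N(t) = β₀₀⁻¹(1 - ϑ₃(π/2, t))`, with the inverse of `β₀₀` as a function on `[0, 1]`. -/
def lowerBound (N : ℕ) (t : ℝ) : ℝ :=
  Function.invFunOn (beta N 0 0) (Set.Icc 0 1) (1 - theta3 (Real.pi / 2) t)

end SpinBoson

end

/-! Lower bound: decompose the coherence matrix `C` as `∑ j, D j` with `D j` positive semidefinite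
and with the diagonal of `P j`. Then `D j ⊙ Q i` is a joint observable for `P` and `C ⊙ Q`. Such
`D j` are Schur products of a matrix that only distinguishes `weight = j` from `weight ≠ j` with a
common Toeplitz matrix of unit diagonal, obtained by rescaling
`q ^ ((j - k) ^ 2) - ϑ₃(π/2, q) δ j k`. The latter is positive semidefinite because its symbol is
`ϑ₃(·, q) - ϑ₃(π/2, q)` and `ϑ₃(·, q)` is smallest at `π/2`: it is the limit of normalised finite
Jacobi products `∏ i < m, ‖1 + q ^ (2 * i + 1) * z‖ ^ 2`, each factor of which is smallest at
`z = -1`.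

Upper bound: by Cauchy–Schwarz, joint measurability of `C ⊙ Q` and `P` bounds
`∑ i, ‖C n m * Q i n m‖` by the fidelity `∑ j, √(P j n n * P j m m)` of the outcome distributions
of `P` in the basis states `n` and `m`; for labels of weight `0` and `1` this fidelity is
`beta N 0 1`. -/

namespace SpinBoson

section PosSemidef

open Matrix

variable {𝕜 ι : Type*} [RCLike 𝕜]

theorem isClosed_setOf_posSemidef : IsClosed {A : Matrix ι ι 𝕜 | A.PosSemidef} := by
  have hquad (x : ι →₀ 𝕜) : Continuous fun A : Matrix ι ι 𝕜 ↦
      x.sum fun i xi ↦ x.sum fun j xj ↦ star xi * A i j * xj := by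
    unfold Finsupp.sum
    fun_prop
  simp only [PosSemidef, IsHermitian, Set.ofPred_and, Set.ofPred_forall]
  exact (isClosed_eq continuous_id.matrix_conjTranspose continuous_id).inter
    (isClosed_iInter fun x ↦ isClosed_le continuous_const (hquad x))

theorem re_diag_nonneg {A : Matrix ι ι 𝕜} (hA : A.PosSemidef) (i : ι) :
    0 ≤ RCLike.re (A i i) :=
  (RCLike.nonneg_iff.1 hA.diag_nonneg).1

theorem norm_apply_le_sqrt_mul_sqrt {A : Matrix ι ι 𝕜} (hA : A.PosSemidef) (i j : ι) :
    ‖A i j‖ ≤ √(RCLike.re (A i i)) * √(RCLike.re (A j j)) := by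
  have hdet : 0 ≤ A i i * A j j - A i j * A j i := by
    have h := (hA.submatrix ![i, j]).det_nonneg
    rwa [det_fin_two] at h
  have hji : A j i = star (A i j) := (hA.isHermitian.apply j i).symm
  have him := (RCLike.nonneg_iff.1 (hA.diag_nonneg (i := i))).2
  rw [hji, RCLike.star_def, RCLike.mul_conj] at hdet
  have hre := (RCLike.nonneg_iff.1 hdet).1
  rw [map_sub, RCLike.mul_re, him, zero_mul, sub_zero, ← RCLike.ofReal_pow,
    RCLike.ofReal_re] at hre
  rw [← Real.sqrt_mul (re_diag_nonneg hA i)]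
  exact Real.le_sqrt_of_sq_le (sub_nonneg.1 hre)

theorem posSemidef_fin_two {p q : ℝ} {b : 𝕜} (hp : 0 ≤ p) (hq : 0 ≤ q) (h : ‖b‖ ^ 2 ≤ p * q) :
    (!![(p : 𝕜), b; star b, (q : 𝕜)]).PosSemidef := by
  obtain rfl | hp' := hp.eq_or_lt
  · have hb : b = 0 := by simpa using h
    have hdiag : !![((0 : ℝ) : 𝕜), b; star b, (q : 𝕜)] = diagonal ![0, (q : 𝕜)] := by
      ext i j
      fin_cases i <;> fin_cases j <;> simp [hb]
    rw [hdiag]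
    refine .diagonal fun i ↦ ?_
    fin_cases i <;> simp [hq]
  · have hsplit : !![(p : 𝕜), b; star b, (q : 𝕜)] =
        ((p⁻¹ : ℝ) : 𝕜) • vecMulVec ![(p : 𝕜), star b] (star ![(p : 𝕜), star b]) +
          diagonal ![0, ((q - ‖b‖ ^ 2 / p : ℝ) : 𝕜)] := by
      have hpc : (p : 𝕜) ≠ 0 := RCLike.ofReal_ne_zero.2 hp'.ne'
      ext i j
      rw [Matrix.add_apply, Matrix.smul_apply, vecMulVec_apply]
      fin_cases i <;> fin_cases j <;>
        simp [hpc, RCLike.conj_mul, mul_left_comm, div_eq_inv_mul]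
    rw [hsplit]
    refine ((posSemidef_vecMulVec_self_star _).smul ?_).add (.diagonal fun i ↦ ?_)
    · exact RCLike.ofReal_nonneg.2 (inv_nonneg.2 hp)
    · fin_cases i
      · simp
      · have hqb : 0 ≤ q - ‖b‖ ^ 2 / p := by
          rw [sub_nonneg, div_le_iff₀' hp']
          exact h
        exact (RCLike.ofReal_nonneg (K := 𝕜)).2 hqb

end PosSemidef

section JointMeasurability

variable {ι : Type} [Fintype ι] [DecidableEq ι]

theorem IsObservable.sum_re_diag {Ω : Type} [Fintype Ω] {M : Ω → Matrix ι ι ℂ}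
    (hM : IsObservable M) (n : ι) : ∑ i, (M i n n).re = 1 := by
  have h := congrArg (fun A : Matrix ι ι ℂ ↦ (A n n).re) hM.2
  simpa [Matrix.sum_apply] using h

theorem IsObservable.norm_apply_le_one {Ω : Type} [Fintype Ω] {M : Ω → Matrix ι ι ℂ}
    (hM : IsObservable M) (i : Ω) (n m : ι) : ‖M i n m‖ ≤ 1 := by
  have hdiag (k : ι) : (M i k k).re ≤ 1 := by
    rw [← hM.sum_re_diag k]
    exact Finset.single_le_sum (f := fun j ↦ (M j k k).re)
      (fun j _ ↦ re_diag_nonneg (hM.1 j) k) (Finset.mem_univ i)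
  exact (norm_apply_le_sqrt_mul_sqrt (hM.1 i) n m).trans <| mul_le_one₀
    (Real.sqrt_le_one.2 (hdiag n)) (Real.sqrt_nonneg _) (Real.sqrt_le_one.2 (hdiag m))

theorem isCompact_setOf_isObservable (Ω : Type) [Fintype Ω] :
    IsCompact {M : Ω → Matrix ι ι ℂ | IsObservable M} := by
  have hbox : IsCompact {M : Ω → Matrix ι ι ℂ | ∀ i, M i ∈ {A : Matrix ι ι ℂ |
      ∀ n, A n ∈ {v : ι → ℂ | ∀ m, v m ∈ Metric.closedBall (0 : ℂ) 1}}} :=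
    isCompact_pi_infinite fun _ ↦ isCompact_pi_infinite fun _ ↦ isCompact_pi_infinite fun _ ↦
      isCompact_closedBall 0 1
  refine hbox.of_isClosed_subset ?_ fun M hM i n m ↦
    mem_closedBall_zero_iff.2 (hM.norm_apply_le_one i n m)
  have hsum : Continuous fun M : Ω → Matrix ι ι ℂ ↦ ∑ i, M i := by fun_prop
  simp only [IsObservable, Set.ofPred_and, Set.ofPred_forall]
  exact (isClosed_iInter fun i ↦ isClosed_setOf_posSemidef.preimage (continuous_apply i)).inter
    (isClosed_eq hsum continuous_const)

theorem isClosed_setOf_jointlyMeasurable {Ω₁ Ω₂ : Type} [Fintype Ω₁] [Fintype Ω₂]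
    (M : Ω₁ → Matrix ι ι ℂ) :
    IsClosed {F : Ω₂ → Matrix ι ι ℂ | JointlyMeasurable M F} := by
  have hjoint : IsCompact {G : Ω₁ × Ω₂ → Matrix ι ι ℂ |
      IsObservable G ∧ ∀ i, ∑ j, G (i, j) = M i} := by
    simp only [Set.ofPred_and, Set.ofPred_forall]
    exact (isCompact_setOf_isObservable _).inter_right <|
      isClosed_iInter fun i ↦ isClosed_eq (by fun_prop) continuous_const
  have hmarginal : Continuous fun (G : Ω₁ × Ω₂ → Matrix ι ι ℂ) j ↦ ∑ i, G (i, j) := by fun_prop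
  convert (hjoint.image hmarginal).isClosed using 1
  ext F
  simp only [JointlyMeasurable, Set.mem_ofPred_eq, Set.mem_image, and_assoc, funext_iff]

theorem isClosed_compatibleSet (C : Matrix ι ι ℂ) (Ω : Type) [Fintype Ω] :
    IsClosed (compatibleSet C Ω) := by
  have hdiag : IsClosed {P : Ω → Matrix ι ι ℂ | IsIncoherent P} := by
    simp only [IsIncoherent, Matrix.IsDiag, Pairwise, Set.ofPred_forall]
    refine isClosed_iInter fun j ↦ isClosed_iInter fun n ↦ isClosed_iInter fun m ↦
      isClosed_iInter fun _ ↦ isClosed_eq ?_ continuous_const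
    exact (continuous_apply j).matrix_elem n m
  simp only [compatibleSet, Set.ofPred_and, Set.ofPred_forall]
  exact (isCompact_setOf_isObservable Ω).isClosed.inter <| hdiag.inter <|
    isClosed_iInter fun _ ↦ isClosed_iInter fun _ ↦ isClosed_iInter fun _ ↦
      isClosed_iInter fun _ ↦ isClosed_setOf_jointlyMeasurable _

theorem mem_compatibleSet_of_decomposition {C : Matrix ι ι ℂ} {Ω : Type} [Fintype Ω]
    {P : Ω → Matrix ι ι ℂ} (hP : IsObservable P) (D : Ω → Matrix ι ι ℂ)
    (hD : ∀ j, (D j).PosSemidef) (hsum : ∑ j, D j = C) (hdiag : ∀ j, D j ⊙ 1 = P j) :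
    P ∈ compatibleSet C Ω := by
  have hincoherent : IsIncoherent P := fun j n m hnm ↦ by simp [← hdiag j, hnm]
  refine ⟨hP, hincoherent, fun Ω' _ Q hQ ↦ ?_⟩
  have hrow (i : Ω') : ∑ j, D j ⊙ Q i = C ⊙ Q i := by
    ext n m
    simp [← hsum, Matrix.sum_apply, Finset.sum_mul]
  have hcol (j : Ω) : ∑ i, D j ⊙ Q i = P j := by
    rw [← hdiag j, ← hQ.2]
    ext n m
    simp [Matrix.sum_apply, Finset.mul_sum]
  refine ⟨fun p ↦ D p.2 ⊙ Q p.1, ⟨fun p ↦ (hD p.2).hadamard (hQ.1 p.1), ?_⟩, hrow, hcol⟩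
  rw [Fintype.sum_prod_type_right, ← hP.2]
  exact Finset.sum_congr rfl fun j _ ↦ hcol j

theorem JointlyMeasurable.sum_norm_apply_le {Ω₁ Ω₂ : Type} [Fintype Ω₁] [Fintype Ω₂]
    {M : Ω₁ → Matrix ι ι ℂ} {F : Ω₂ → Matrix ι ι ℂ} (h : JointlyMeasurable M F) (n m : ι) :
    ∑ i, ‖M i n m‖ ≤ ∑ j, √(F j n n).re * √(F j m m).re := by
  obtain ⟨G, hG, hM, hF⟩ := h
  have hF' (j : Ω₂) (k : ι) : (F j k k).re = ∑ i, (G (i, j) k k).re := by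
    simp [← hF j, Matrix.sum_apply]
  calc ∑ i, ‖M i n m‖ ≤ ∑ i, ∑ j, ‖G (i, j) n m‖ := Finset.sum_le_sum fun i _ ↦ by
        rw [← hM i, Matrix.sum_apply]
        exact norm_sum_le _ _
    _ = ∑ j, ∑ i, ‖G (i, j) n m‖ := Finset.sum_comm
    _ ≤ ∑ j, ∑ i, √(G (i, j) n n).re * √(G (i, j) m m).re := by
        gcongr with j _ i _
        exact norm_apply_le_sqrt_mul_sqrt (hG.1 (i, j)) n m
    _ ≤ ∑ j, √(F j n n).re * √(F j m m).re := by
        simp only [hF']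
        gcongr with j _
        exact Real.sum_sqrt_mul_sqrt_le _ (fun i ↦ re_diag_nonneg (hG.1 (i, j)) n)
          fun i ↦ re_diag_nonneg (hG.1 (i, j)) m

theorem isObservable_of_involution {S : Matrix ι ι ℂ} (hS : S.IsHermitian) (hSS : S * S = 1) :
    IsObservable ![(1 / 2 : ℂ) • (1 + S), (1 / 2 : ℂ) • (1 - S)] := by
  have hproj {T : Matrix ι ι ℂ} (hT : T.IsHermitian) (hTT : T * T = 1) :
      ((1 / 2 : ℂ) • (1 + T)).PosSemidef := by
    have hherm : ((1 / 2 : ℂ) • (1 + T)).IsHermitian :=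
      (Matrix.isHermitian_one.add hT).smul (by simp [IsSelfAdjoint])
    have hsq : (1 + T) * (1 + T) = (2 : ℂ) • (1 + T) := by
      rw [add_mul, one_mul, mul_add, mul_one, hTT, add_comm T 1, two_smul]
    have hidem : (1 / 2 : ℂ) • (1 + T) * ((1 / 2 : ℂ) • (1 + T))ᴴ = (1 / 2 : ℂ) • (1 + T) := by
      rw [hherm, smul_mul_smul_comm, hsq, smul_smul]
      norm_num
    exact hidem ▸ Matrix.posSemidef_self_mul_conjTranspose _
  refine ⟨Fin.forall_fin_two.2 ⟨hproj hS hSS, ?_⟩, ?_⟩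
  · simpa [sub_eq_add_neg] using hproj hS.neg (by simpa using hSS)
  · rw [Fin.sum_univ_two, Matrix.cons_val_zero, Matrix.cons_val_one,
      Matrix.cons_val_fin_one]
    module

/-- The coherence between two basis vectors is detected by the observable that distinguishes the
symmetric from the antisymmetric vectors under their exchange. -/
theorem norm_apply_le_of_mem_compatibleSet {C : Matrix ι ι ℂ} {Ω : Type} [Fintype Ω]
    {P : Ω → Matrix ι ι ℂ} (hP : P ∈ compatibleSet C Ω) {n m : ι} (hnm : n ≠ m) :
    ‖C n m‖ ≤ ∑ j, √(P j n n).re * √(P j m m).re := by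
  set S : Matrix ι ι ℂ := (Equiv.swap n m).permMatrix ℂ with hS
  have hobs := isObservable_of_involution (S := S)
    (by rw [Matrix.IsHermitian, hS, Matrix.conjTranspose_permMatrix]; simp)
    (by rw [hS, ← Matrix.permMatrix_mul]; simp)
  have hSnm : S n m = 1 := by simp [hS]
  have hsum : ‖C n m‖ = ‖C n m * (1 / 2)‖ + ‖C n m * -(1 / 2)‖ := by
    norm_num [norm_mul, ← mul_add]
  have hle := (hP.2.2 _ _ hobs).sum_norm_apply_le n m
  rw [hsum]
  simpa [hSnm, hnm] using hle

end JointMeasurability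

section Circulant

open MeasureTheory AddCircle

theorem norm_fourier_apply {T : ℝ} (d : ℤ) (θ : AddCircle T) : ‖fourier d θ‖ = 1 := by
  rw [fourier_apply, Circle.norm_coe]

variable {T : ℝ} [Fact (0 < T)]

theorem isHermitian_circulant_fourierCoeff {f : AddCircle T → ℂ} (hf : ∀ θ, 0 ≤ f θ) :
    (Matrix.circulant (fourierCoeff f)).IsHermitian := by
  ext i j
  rw [Matrix.conjTranspose_apply, Matrix.circulant_apply, Matrix.circulant_apply, fourierCoeff,
    RCLike.star_def, ← integral_conj, fourierCoeff]
  refine integral_congr_ae (.of_forall fun θ ↦ ?_)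
  simp only [smul_eq_mul, map_mul, ← fourier_neg, neg_sub]
  rw [Complex.conj_eq_iff_im.2 (Complex.nonneg_iff.1 (hf θ)).2.symm]

theorem sum_fourierCoeff_eq_integral {f : AddCircle T → ℂ}
    (hf : Integrable f haarAddCircle) (s : Finset ℤ) (x : ℤ → ℂ) :
    ∑ i ∈ s, ∑ j ∈ s, star (x i) * fourierCoeff f (i - j) * x j =
      ∫ θ, (‖∑ i ∈ s, x i * fourier i θ‖ ^ 2 : ℝ) * f θ ∂haarAddCircle := by
  have hint (i j : ℤ) :
      Integrable (fun θ ↦ star (x i) * (fourier (-(i - j)) θ • f θ) * x j) haarAddCircle :=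
    ((hf.fourier_smul _).const_mul _).mul_const _
  have hexp (i j : ℤ) (θ : AddCircle T) :
      fourier (-(i - j)) θ = fourier (-i) θ * fourier j θ := by
    rw [← fourier_add, neg_sub, sub_eq_neg_add]
  have hsq (θ : AddCircle T) : ((‖∑ i ∈ s, x i * fourier i θ‖ ^ 2 : ℝ) : ℂ) * f θ =
      ∑ i ∈ s, ∑ j ∈ s, star (x i) * (fourier (-(i - j)) θ • f θ) * x j := by
    rw [Complex.ofReal_pow, ← Complex.conj_mul', map_sum, Finset.sum_mul_sum, Finset.sum_mul]
    simp only [Finset.sum_mul, map_mul, ← fourier_neg, smul_eq_mul, RCLike.star_def, hexp]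
    exact Finset.sum_congr rfl fun i _ ↦ Finset.sum_congr rfl fun j _ ↦ by ring
  simp only [hsq]
  rw [integral_finsetSum _ fun i _ ↦ integrable_finsetSum _ fun j _ ↦ hint i j]
  simp only [integral_finsetSum _ fun j _ ↦ hint _ j, integral_const_mul, integral_mul_const,
    fourierCoeff]

theorem posSemidef_circulant_fourierCoeff {f : AddCircle T → ℂ}
    (hf : Integrable f haarAddCircle) (hf0 : ∀ θ, 0 ≤ f θ) :
    (Matrix.circulant (fourierCoeff f)).PosSemidef := by
  refine ⟨isHermitian_circulant_fourierCoeff hf0, fun x ↦ ?_⟩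
  have hquad := sum_fourierCoeff_eq_integral hf x.support x
  simp only [Finsupp.sum, Matrix.circulant_apply, hquad]
  exact integral_nonneg fun θ ↦ mul_nonneg (Complex.zero_le_real.2 (sq_nonneg _)) (hf0 θ)

theorem integrable_mul_fourier (c : ℂ) (d : ℤ) :
    Integrable (fun θ : AddCircle T ↦ c * fourier d θ) haarAddCircle :=
  Continuous.integrable_of_hasCompactSupport (by fun_prop) (.of_compactSpace _)

theorem integrable_tsum_mul_fourier {a : ℤ → ℂ} (ha : Summable a) :
    Integrable (fun θ : AddCircle T ↦ ∑' d, a d * fourier d θ) haarAddCircle :=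
  (continuous_tsum (fun d ↦ by fun_prop) ha.norm fun d θ ↦ by
    rw [norm_mul, norm_fourier_apply, mul_one]).integrable_of_hasCompactSupport (.of_compactSpace _)

theorem fourierCoeff_tsum_mul_fourier {a : ℤ → ℂ} (ha : Summable a) :
    fourierCoeff (fun θ : AddCircle T ↦ ∑' d, a d * fourier d θ) = a := by
  ext n
  have hcoeff (d : ℤ) :
      ∫ θ : AddCircle T, fourier (-n) θ • (a d * fourier d θ) ∂haarAddCircle =
        if d = n then a n else 0 := by
    rw [← fourierCoeff, fourierCoeff.const_mul, fourierCoeff_fourier]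
    obtain rfl | hdn := eq_or_ne d n
    · simp
    · simp [hdn, hdn.symm]
  have hsum : Summable fun d ↦
      ∫ θ : AddCircle T, ‖fourier (-n) θ • (a d * fourier d θ)‖ ∂haarAddCircle := by
    simpa only [norm_smul, norm_mul, norm_fourier_apply, one_mul, mul_one, integral_const,
      probReal_univ, one_smul] using ha.norm
  have h := hasSum_integral_of_summable_integral_norm
    (fun d ↦ (integrable_mul_fourier (T := T) (a d) d).fourier_smul (-n)) hsum
  simp only [hcoeff, tsum_const_smul''] at h
  exact h.unique (hasSum_ite_eq n (a n))

theorem posSemidef_circulant_of_tsum_nonneg {a : ℤ → ℂ} (ha : Summable a)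
    (hpos : ∀ z : Circle, 0 ≤ ∑' d, a d * (z : ℂ) ^ d) : (Matrix.circulant a).PosSemidef := by
  have h := posSemidef_circulant_fourierCoeff (T := 1) (integrable_tsum_mul_fourier ha) fun θ ↦ by
    simpa [fourier_apply, toCircle_zsmul] using hpos (toCircle θ)
  rwa [fourierCoeff_tsum_mul_fourier ha] at h

end Circulant

section JacobiProduct

open Filter Topology

/-- The Laurent coefficients of the finite Jacobi product
`∏ i < m, (1 + q ^ (2 * i + 1) * z) * (1 + q ^ (2 * i + 1) * z⁻¹)`, built up factor by factor. -/
def jacobiCoeff (q : ℝ) : ℕ → ℤ → ℝ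
  | 0, d => if d = 0 then 1 else 0
  | m + 1, d => (1 + (q ^ (2 * m + 1)) ^ 2) * jacobiCoeff q m d +
      q ^ (2 * m + 1) * (jacobiCoeff q m (d - 1) + jacobiCoeff q m (d + 1))

/-- The finite Jacobi product on the unit circle, where the two factors with the same exponent are
complex conjugate. -/
noncomputable def jacobiProd (q : ℝ) (m : ℕ) (z : Circle) : ℝ :=
  ∏ i ∈ Finset.range m, ‖1 + (q : ℂ) ^ (2 * i + 1) * z‖ ^ 2

variable {q : ℝ}

theorem hasSum_comp_add_right_mul_zpow {c : ℤ → ℂ} {z x : ℂ} (hz : z ≠ 0)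
    (h : HasSum (fun d ↦ c d * z ^ d) x) (k : ℤ) :
    HasSum (fun d ↦ c (d + k) * z ^ d) (z ^ (-k) * x) := by
  refine (((Equiv.addRight k).hasSum_iff.2 h).mul_left (z ^ (-k))).congr_fun fun d ↦ ?_
  simp only [Function.comp_apply, Equiv.coe_addRight]
  rw [mul_left_comm, ← zpow_add₀ hz, neg_add_cancel_comm_assoc]

theorem ofReal_norm_one_add_mul_sq (y : ℝ) (z : Circle) :
    ((‖1 + (y : ℂ) * z‖ ^ 2 : ℝ) : ℂ) = 1 + (y : ℂ) ^ 2 + y * (z + (z : ℂ)⁻¹) := by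
  rw [Complex.ofReal_pow, ← Complex.mul_conj', map_add, map_one, map_mul, Complex.conj_ofReal,
    ← Circle.coe_inv_eq_conj, Circle.coe_inv]
  field_simp
  ring

theorem hasSum_jacobiCoeff (q : ℝ) (m : ℕ) (z : Circle) :
    HasSum (fun d : ℤ ↦ (jacobiCoeff q m d : ℂ) * (z : ℂ) ^ d) (jacobiProd q m z) := by
  induction m with
  | zero =>
    convert hasSum_single (f := fun d ↦ (jacobiCoeff q 0 d : ℂ) * (z : ℂ) ^ d) 0 fun d hd ↦ ?_
    · simp [jacobiProd, jacobiCoeff]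
    · simp [jacobiCoeff, hd]
  | succ m ih =>
    set y : ℝ := q ^ (2 * m + 1) with hy
    have hprod : ((jacobiProd q (m + 1) z : ℝ) : ℂ) = (1 + (y : ℂ) ^ 2) * jacobiProd q m z +
        y * (z ^ (-(-1 : ℤ)) * jacobiProd q m z + z ^ (-1 : ℤ) * jacobiProd q m z) := by
      rw [jacobiProd, Finset.prod_range_succ, ← jacobiProd, Complex.ofReal_mul,
        ← Complex.ofReal_pow, ofReal_norm_one_add_mul_sq, neg_neg, zpow_one, zpow_neg_one]
      ring
    rw [hprod]
    refine ((ih.mul_left _).add (((hasSum_comp_add_right_mul_zpow z.coe_ne_zero ih (-1)).add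
      (hasSum_comp_add_right_mul_zpow z.coe_ne_zero ih 1)).mul_left _)).congr_fun fun d ↦ ?_
    rw [jacobiCoeff, ← hy, sub_eq_add_neg]
    push_cast
    ring

theorem jacobiCoeff_nonneg (hq : 0 ≤ q) (m : ℕ) (d : ℤ) : 0 ≤ jacobiCoeff q m d := by
  induction m generalizing d with
  | zero =>
    rw [jacobiCoeff]
    split_ifs <;> simp
  | succ m ih =>
    have h0 := ih d
    have h1 := ih (d - 1)
    have h2 := ih (d + 1)
    rw [jacobiCoeff]
    positivity

theorem jacobiCoeff_zero_right_pos (hq : 0 ≤ q) (m : ℕ) : 0 < jacobiCoeff q m 0 := by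
  induction m with
  | zero => simp [jacobiCoeff]
  | succ m ih =>
    have h1 := jacobiCoeff_nonneg hq m (0 - 1)
    have h2 := jacobiCoeff_nonneg hq m (0 + 1)
    rw [jacobiCoeff]
    positivity

theorem jacobiCoeff_neg (q : ℝ) (m : ℕ) (d : ℤ) : jacobiCoeff q m (-d) = jacobiCoeff q m d := by
  induction m generalizing d with
  | zero => simp [jacobiCoeff]
  | succ m ih =>
    rw [jacobiCoeff, jacobiCoeff, ih, ← ih (d - 1), ← ih (d + 1), neg_sub, neg_add',
      neg_add_eq_sub, add_comm (jacobiCoeff q m (1 - d))]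

/-- This expresses the functional equation of the finite Jacobi product under `z ↦ q ^ 2 * z`. -/
theorem jacobiCoeff_mul_eq (hq : q ≠ 0) (m : ℕ) (d : ℤ) :
    q * jacobiCoeff q m d * (1 - q ^ (2 * m) * (q ^ 2) ^ d) =
      jacobiCoeff q m (d - 1) * ((q ^ 2) ^ d - q ^ (2 * m) * q ^ 2) := by
  induction m generalizing d with
  | zero =>
    obtain rfl | hd := eq_or_ne d 0
    · simp [jacobiCoeff]
    obtain rfl | hd' := eq_or_ne d 1
    · simp [jacobiCoeff]
    · simp [jacobiCoeff, hd, sub_ne_zero.2 hd']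
  | succ m ih =>
    have hcur : (q ^ 2) ^ d = (q ^ 2) ^ (d - 1) * q ^ 2 := by
      rw [← zpow_add_one₀ (pow_ne_zero 2 hq), sub_add_cancel]
    have hnext : (q ^ 2) ^ (d + 1) = (q ^ 2) ^ (d - 1) * q ^ 2 * q ^ 2 := by
      rw [zpow_add_one₀ (pow_ne_zero 2 hq), hcur]
    have ihprev := ih (d - 1)
    have ihcur := ih d
    have ihnext := ih (d + 1)
    rw [hnext, add_sub_cancel_right] at ihnext
    rw [hcur] at ihcur
    rw [jacobiCoeff, jacobiCoeff, hcur, sub_add_cancel]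
    linear_combination q ^ (2 * m + 3) * ihprev + (1 + q ^ (4 * m + 4)) * ihcur +
      q ^ (2 * m + 1) * ihnext

theorem jacobiCoeff_add_one_mul_eq (hq : q ≠ 0) (m d : ℕ) :
    jacobiCoeff q m (d + 1) * (1 - q ^ (2 * m) * q ^ (2 * d + 2)) =
      jacobiCoeff q m d * (q ^ (2 * d + 1) - q ^ (2 * m) * q) := by
  have h := jacobiCoeff_mul_eq hq m (d + 1)
  have hpow : (q ^ 2) ^ ((d : ℤ) + 1) = q ^ (2 * d + 2) := by
    rw [← Nat.cast_add_one, zpow_natCast, ← pow_mul, mul_add_one]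
  rw [hpow, add_sub_cancel_right] at h
  refine mul_left_cancel₀ hq ?_
  linear_combination h

theorem jacobiCoeff_natCast_le (hq : 0 < q) (hq1 : q < 1) (m d : ℕ) :
    jacobiCoeff q m d ≤ q ^ (d ^ 2) * jacobiCoeff q m 0 := by
  induction d with
  | zero => simp
  | succ d ih =>
    have hpos : 0 < 1 - q ^ (2 * m) * q ^ (2 * d + 2) := by
      rw [← pow_add, sub_pos]
      exact pow_lt_one₀ hq.le hq1 (by omega)
    have hstep : q ^ (2 * d + 1) - q ^ (2 * m) * q ≤
        q ^ (2 * d + 1) * (1 - q ^ (2 * m) * q ^ (2 * d + 2)) := by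
      have h : q ^ (2 * m) * q ^ (4 * d + 3) ≤ q ^ (2 * m) * q ^ 1 := by
        gcongr ?_ * ?_
        exact pow_le_pow_of_le_one hq.le hq1.le (by omega)
      linear_combination h
    refine le_of_mul_le_mul_right ?_ hpos
    calc jacobiCoeff q m (d + 1 : ℕ) * (1 - q ^ (2 * m) * q ^ (2 * d + 2))
        = jacobiCoeff q m d * (q ^ (2 * d + 1) - q ^ (2 * m) * q) := by
          rw [Nat.cast_add_one, jacobiCoeff_add_one_mul_eq hq.ne']
      _ ≤ jacobiCoeff q m d * (q ^ (2 * d + 1) * (1 - q ^ (2 * m) * q ^ (2 * d + 2))) :=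
          mul_le_mul_of_nonneg_left hstep (jacobiCoeff_nonneg hq.le m d)
      _ ≤ q ^ d ^ 2 * jacobiCoeff q m 0 *
            (q ^ (2 * d + 1) * (1 - q ^ (2 * m) * q ^ (2 * d + 2))) := by gcongr
      _ = q ^ (d + 1) ^ 2 * jacobiCoeff q m 0 * (1 - q ^ (2 * m) * q ^ (2 * d + 2)) := by ring

theorem tendsto_jacobiCoeff_natCast_div (hq : 0 < q) (hq1 : q < 1) (d : ℕ) :
    Tendsto (fun m ↦ jacobiCoeff q m d / jacobiCoeff q m 0) atTop (𝓝 (q ^ (d ^ 2))) := by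
  induction d with
  | zero => simp [div_self (jacobiCoeff_zero_right_pos hq.le _).ne']
  | succ d ih =>
    have hpow : Tendsto (fun m : ℕ ↦ q ^ (2 * m)) atTop (𝓝 0) := by
      simpa only [pow_mul] using tendsto_pow_atTop_nhds_zero_of_lt_one (sq_nonneg q)
        (pow_lt_one₀ hq.le hq1 two_ne_zero)
    have hratio : Tendsto (fun m : ℕ ↦ (q ^ (2 * d + 1) - q ^ (2 * m) * q) /
        (1 - q ^ (2 * m) * q ^ (2 * d + 2))) atTop (𝓝 (q ^ (2 * d + 1))) := by
      have hnum := (hpow.mul_const q).const_sub (q ^ (2 * d + 1))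
      have hden := (hpow.mul_const (q ^ (2 * d + 2))).const_sub 1
      have h := hnum.div hden (by simp)
      rwa [zero_mul, sub_zero, zero_mul, sub_zero, div_one] at h
    have hstep (m : ℕ) : jacobiCoeff q m (d + 1 : ℕ) / jacobiCoeff q m 0 =
        jacobiCoeff q m d / jacobiCoeff q m 0 * ((q ^ (2 * d + 1) - q ^ (2 * m) * q) /
          (1 - q ^ (2 * m) * q ^ (2 * d + 2))) := by
      have hpos : 0 < 1 - q ^ (2 * m) * q ^ (2 * d + 2) := by
        rw [← pow_add, sub_pos]
        exact pow_lt_one₀ hq.le hq1 (by omega)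
      rw [Nat.cast_add_one, eq_div_of_mul_eq hpos.ne' (jacobiCoeff_add_one_mul_eq hq.ne' m d)]
      ring
    simp only [hstep]
    convert ih.mul hratio using 2
    ring

theorem jacobiCoeff_le (hq : 0 < q) (hq1 : q < 1) (m : ℕ) (d : ℤ) :
    jacobiCoeff q m d ≤ q ^ (d.natAbs ^ 2) * jacobiCoeff q m 0 := by
  obtain ⟨n, rfl | rfl⟩ := d.eq_nat_or_neg
  · exact jacobiCoeff_natCast_le hq hq1 m n
  · rw [jacobiCoeff_neg, Int.natAbs_neg]
    exact jacobiCoeff_natCast_le hq hq1 m n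

theorem tendsto_jacobiCoeff_div (hq : 0 < q) (hq1 : q < 1) (d : ℤ) :
    Tendsto (fun m ↦ jacobiCoeff q m d / jacobiCoeff q m 0) atTop (𝓝 (q ^ (d.natAbs ^ 2))) := by
  obtain ⟨n, rfl | rfl⟩ := d.eq_nat_or_neg
  · exact tendsto_jacobiCoeff_natCast_div hq hq1 n
  · simp only [jacobiCoeff_neg, Int.natAbs_neg]
    exact tendsto_jacobiCoeff_natCast_div hq hq1 n

end JacobiProduct

section Theta

open Filter Topology

variable {q : ℝ}

theorem summable_pow_natAbs_sq (hq : |q| < 1) :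
    Summable fun d : ℤ ↦ (q : ℂ) ^ (d.natAbs ^ 2) := by
  have hnat : Summable fun n : ℕ ↦ (q : ℂ) ^ (n ^ 2) := by
    refine .of_norm_bounded (summable_geometric_of_lt_one (abs_nonneg q) hq) fun n ↦ ?_
    rw [norm_pow, Complex.norm_real, Real.norm_eq_abs]
    exact pow_le_pow_of_le_one (abs_nonneg q) hq.le (Nat.le_self_pow two_ne_zero n)
  exact .of_nat_of_neg (by simpa using hnat) (by simpa using hnat)

theorem summable_pow_natAbs_sq_mul_zpow (hq : |q| < 1) (z : Circle) :
    Summable fun d : ℤ ↦ (q : ℂ) ^ (d.natAbs ^ 2) * (z : ℂ) ^ d := by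
  refine .of_norm ?_
  simpa only [norm_mul, norm_zpow, Circle.norm_coe, one_zpow, mul_one] using
    (summable_pow_natAbs_sq hq).norm

theorem exp_two_mul_zpow_add_zpow_neg (x : ℝ) (n : ℕ) :
    (Circle.exp (2 * x) : ℂ) ^ (n : ℤ) + (Circle.exp (2 * x) : ℂ) ^ (-n : ℤ) =
      2 * Real.cos (2 * n * x) := by
  rw [Circle.coe_exp, ← Complex.exp_int_mul, ← Complex.exp_int_mul, Complex.ofReal_cos,
    Complex.two_cos]
  push_cast
  ring_nf

theorem ofReal_theta3Series (x : ℝ) (hq : |q| < 1) :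
    (theta3Series x q : ℂ) =
      ∑' d : ℤ, (q : ℂ) ^ (d.natAbs ^ 2) * (Circle.exp (2 * x) : ℂ) ^ d := by
  have hsum := summable_pow_natAbs_sq_mul_zpow hq (Circle.exp (2 * x))
  have hpair (n : ℕ) : (q : ℂ) ^ ((n : ℤ).natAbs ^ 2) * (Circle.exp (2 * x) : ℂ) ^ (n : ℤ) +
      (q : ℂ) ^ ((-n : ℤ).natAbs ^ 2) * (Circle.exp (2 * x) : ℂ) ^ (-n : ℤ) =
        (2 * (q ^ (n ^ 2) * Real.cos (2 * n * x)) : ℝ) := by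
    rw [Int.natAbs_neg, ← mul_add, exp_two_mul_zpow_add_zpow_neg, Int.natAbs_natCast]
    push_cast
    ring
  have h := (tsum_nat_add_neg hsum).symm.trans hsum.nat_add_neg.tsum_eq_zero_add
  simp only [hpair] at h
  rw [← Complex.ofReal_tsum, tsum_mul_left] at h
  rw [theta3Series]
  push_cast at h ⊢
  simp only [pow_zero, zpow_ofNat, mul_one, mul_zero, zero_mul, Complex.cos_zero] at h ⊢
  linear_combination -h

theorem tendsto_jacobiProd_div (hq : 0 < q) (hq1 : q < 1) (x : ℝ) :
    Tendsto (fun m ↦ jacobiProd q m (Circle.exp (2 * x)) / jacobiCoeff q m 0) atTop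
      (𝓝 (theta3Series x q)) := by
  set z := Circle.exp (2 * x)
  have hq' : |q| < 1 := by rwa [abs_of_pos hq]
  have hseries (m : ℕ) : ((jacobiProd q m z / jacobiCoeff q m 0 : ℝ) : ℂ) =
      ∑' d : ℤ, ((jacobiCoeff q m d / jacobiCoeff q m 0 : ℝ) : ℂ) * (z : ℂ) ^ d := by
    rw [Complex.ofReal_div, ← ((hasSum_jacobiCoeff q m z).div_const _).tsum_eq]
    simp only [Complex.ofReal_div, div_mul_eq_mul_div]
  rw [← tendsto_ofReal_iff]
  simp only [hseries, ofReal_theta3Series x hq']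
  refine tendsto_tsum_of_dominated_convergence (summable_pow_natAbs_sq hq').norm (fun d ↦ ?_)
    (.of_forall fun m d ↦ ?_)
  · refine Tendsto.mul_const _ ?_
    exact_mod_cast (Complex.continuous_ofReal.tendsto _).comp (tendsto_jacobiCoeff_div hq hq1 d)
  · have hpos := jacobiCoeff_zero_right_pos hq.le m
    rw [norm_mul, norm_zpow, Circle.norm_coe, one_zpow, mul_one, Complex.norm_real, norm_pow,
      Complex.norm_real, Real.norm_of_nonneg hq.le,
      Real.norm_of_nonneg (div_nonneg (jacobiCoeff_nonneg hq.le m d) hpos.le), div_le_iff₀ hpos]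
    exact jacobiCoeff_le hq hq1 m d

theorem theta3Series_nonneg (hq : 0 ≤ q) (hq1 : q < 1) (x : ℝ) : 0 ≤ theta3Series x q := by
  obtain rfl | hq := hq.eq_or_lt
  · simp [theta3Series]
  exact ge_of_tendsto' (tendsto_jacobiProd_div hq hq1 x) fun m ↦
    div_nonneg (Finset.prod_nonneg fun i _ ↦ sq_nonneg _) (jacobiCoeff_zero_right_pos hq.le m).le

theorem norm_one_add_mul_exp_pi {y : ℝ} (hy : y ≤ 1) :
    ‖1 + (y : ℂ) * Circle.exp Real.pi‖ = 1 - y := by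
  rw [Circle.coe_exp, Complex.exp_pi_mul_I, mul_neg_one, ← sub_eq_add_neg, ← Complex.ofReal_one,
    ← Complex.ofReal_sub, Complex.norm_of_nonneg (sub_nonneg.2 hy)]

theorem norm_one_add_mul_exp_pi_le {y : ℝ} (hy0 : 0 ≤ y) (hy1 : y ≤ 1) (z : Circle) :
    ‖1 + (y : ℂ) * Circle.exp Real.pi‖ ≤ ‖1 + (y : ℂ) * z‖ := by
  rw [norm_one_add_mul_exp_pi hy1]
  simpa only [norm_one, norm_mul, Circle.norm_coe, mul_one, Complex.norm_of_nonneg hy0,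
    tsub_le_iff_right] using norm_sub_le_norm_add (1 : ℂ) (y * z)

theorem theta3Series_pi_div_two_le (hq : 0 ≤ q) (hq1 : q < 1) (x : ℝ) :
    theta3Series (Real.pi / 2) q ≤ theta3Series x q := by
  obtain rfl | hq := hq.eq_or_lt
  · simp [theta3Series]
  refine le_of_tendsto_of_tendsto' (tendsto_jacobiProd_div hq hq1 _)
    (tendsto_jacobiProd_div hq hq1 x) fun m ↦ ?_
  have hpos := jacobiCoeff_zero_right_pos hq.le m
  rw [mul_div_cancel₀ _ two_ne_zero]
  unfold jacobiProd
  gcongr with i _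
  exact_mod_cast norm_one_add_mul_exp_pi_le (pow_nonneg hq.le _)
    (pow_le_one₀ hq.le hq1.le) (Circle.exp (2 * x))

theorem one_add_sq_mul_theta3Series_pi_div_two_le (hq : 0 < q) (hq1 : q < 1) :
    (1 + q) ^ 2 * theta3Series (Real.pi / 2) q ≤ (1 - q) ^ 2 * theta3Series 0 q := by
  have hprod (z : Circle) (m : ℕ) : jacobiProd q (m + 1) z =
      ‖1 + (q : ℂ) * z‖ ^ 2 * ∏ i ∈ Finset.range m, ‖1 + (q : ℂ) ^ (2 * (i + 1) + 1) * z‖ ^ 2 := by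
    rw [jacobiProd, Finset.prod_range_succ', mul_comm]
    simp
  have hone : ‖1 + (q : ℂ) * (1 : Circle)‖ = 1 + q := by
    rw [Circle.coe_one, mul_one, ← Complex.ofReal_one, ← Complex.ofReal_add,
      Complex.norm_of_nonneg (by positivity)]
  have hleft := ((tendsto_jacobiProd_div hq hq1 (Real.pi / 2)).const_mul ((1 + q) ^ 2)).comp
    (tendsto_add_atTop_nat 1)
  have hright := ((tendsto_jacobiProd_div hq hq1 0).const_mul ((1 - q) ^ 2)).comp
    (tendsto_add_atTop_nat 1)
  refine le_of_tendsto_of_tendsto' hleft hright fun m ↦ ?_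
  have hpos := jacobiCoeff_zero_right_pos hq.le (m + 1)
  rw [Function.comp_apply, Function.comp_apply, mul_div_cancel₀ _ two_ne_zero, mul_zero,
    Circle.exp_zero, ← mul_div_assoc, ← mul_div_assoc, hprod, hprod, hone,
    norm_one_add_mul_exp_pi hq1.le, mul_left_comm]
  gcongr _ * (_ * ∏ i ∈ _, ?_ ^ 2) / _ with i _
  exact_mod_cast norm_one_add_mul_exp_pi_le (pow_nonneg hq.le _) (pow_le_one₀ hq.le hq1.le) 1

theorem theta3Series_zero_left_mul_le (hq : 0 ≤ q) (hq1 : q < 1) :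
    theta3Series 0 q * (1 - q) ≤ 1 + q := by
  have hgeom : Summable fun k : ℕ ↦ q ^ (k + 1) := by
    simpa only [pow_succ'] using (summable_geometric_of_lt_one hq hq1).mul_left q
  have hterm (k : ℕ) : q ^ ((k + 1) ^ 2) ≤ q ^ (k + 1) :=
    pow_le_pow_of_le_one hq hq1.le (Nat.le_self_pow two_ne_zero _)
  have hsum : ∑' k : ℕ, q ^ ((k + 1) ^ 2) ≤ q * (1 - q)⁻¹ := by
    refine (Summable.tsum_le_tsum hterm (.of_nonneg_of_le (fun k ↦ pow_nonneg hq _) hterm hgeom)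
      hgeom).trans_eq ?_
    simp only [pow_succ', tsum_mul_left, tsum_geometric_of_lt_one hq hq1]
  simp only [theta3Series, mul_zero, Real.cos_zero, mul_one]
  have h1 := sub_pos.2 hq1
  rw [← div_eq_mul_inv, le_div_iff₀ h1] at hsum
  linear_combination 2 * hsum

theorem theta3Series_pi_div_two_le_one_sub (hq : 0 ≤ q) (hq1 : q < 1) :
    theta3Series (Real.pi / 2) q ≤ 1 - q := by
  obtain rfl | hq := hq.eq_or_lt
  · simp [theta3Series]
  have h1 : 0 < 1 - q := sub_pos.2 hq1
  have hbound : (1 + q) ^ 2 * theta3Series (Real.pi / 2) q ≤ (1 + q) * (1 - q) := by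
    calc (1 + q) ^ 2 * theta3Series (Real.pi / 2) q
        ≤ (1 - q) ^ 2 * theta3Series 0 q := one_add_sq_mul_theta3Series_pi_div_two_le hq hq1
      _ = theta3Series 0 q * (1 - q) * (1 - q) := by ring
      _ ≤ (1 + q) * (1 - q) :=
          mul_le_mul_of_nonneg_right (theta3Series_zero_left_mul_le hq.le hq1) h1.le
  have hsq : (1 + q) * (1 - q) ≤ (1 + q) ^ 2 * (1 - q) := by
    gcongr
    exact le_self_pow₀ (by linarith) two_ne_zero
  exact le_of_mul_le_mul_left (hbound.trans hsq) (by positivity)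

theorem tendsto_theta3Series_pi_div_two :
    Tendsto (theta3Series (Real.pi / 2)) (𝓝[<] 1) (𝓝 0) := by
  have hlim : Tendsto (fun q : ℝ ↦ 1 - q) (𝓝[<] 1) (𝓝 0) := by
    have h : Tendsto (fun q : ℝ ↦ 1 - q) (𝓝 1) (𝓝 (1 - 1)) := tendsto_id.const_sub 1
    rw [sub_self] at h
    exact h.mono_left nhdsWithin_le_nhds
  have hmem : ∀ᶠ q : ℝ in 𝓝[<] 1, 0 ≤ q ∧ q < 1 := by
    filter_upwards [Ioo_mem_nhdsLT (zero_lt_one' ℝ)] with q hq using ⟨hq.1.le, hq.2⟩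
  exact squeeze_zero' (hmem.mono fun q hq ↦ theta3Series_nonneg hq.1 hq.2 _)
    (hmem.mono fun q hq ↦ theta3Series_pi_div_two_le_one_sub hq.1 hq.2) hlim

theorem theta3_of_lt_one (x : ℝ) (hq1 : q < 1) : theta3 x q = theta3Series x q := if_pos hq1

theorem theta3_pi_div_two_one : theta3 (Real.pi / 2) 1 = 0 := by
  rw [theta3, if_neg (lt_irrefl 1)]
  exact tendsto_theta3Series_pi_div_two.limUnder_eq

theorem theta3_pi_div_two_mem_Icc (hq : q ∈ Set.Icc (0 : ℝ) 1) :
    theta3 (Real.pi / 2) q ∈ Set.Icc (0 : ℝ) 1 := by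
  obtain rfl | hq1 := hq.2.eq_or_lt
  · simp [theta3_pi_div_two_one]
  rw [theta3_of_lt_one _ hq1]
  exact ⟨theta3Series_nonneg hq.1 hq1 _,
    (theta3Series_pi_div_two_le_one_sub hq.1 hq1).trans (sub_le_self 1 hq.1)⟩

theorem posSemidef_circulant_sub_theta3 (hq : q ∈ Set.Icc (0 : ℝ) 1) :
    (Matrix.circulant fun d : ℤ ↦ (q : ℂ) ^ (d.natAbs ^ 2) -
      if d = 0 then (theta3 (Real.pi / 2) q : ℂ) else 0).PosSemidef := by
  obtain rfl | hq1 := hq.2.eq_or_lt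
  · have h := (Matrix.PosSemidef.one (n := Unit) (R := ℂ)).submatrix fun _ : ℤ ↦ ()
    convert h using 1
    ext i j
    simp [theta3_pi_div_two_one]
  have hq' : |q| < 1 := by rwa [abs_of_nonneg hq.1]
  have hdelta (z : Circle) (c : ℂ) :
      HasSum (fun d : ℤ ↦ (if d = 0 then c else 0) * (z : ℂ) ^ d) c := by
    convert hasSum_ite_eq (0 : ℤ) c using 2 with d
    split_ifs with hd <;> simp [hd]
  refine posSemidef_circulant_of_tsum_nonneg
    ((summable_pow_natAbs_sq hq').sub (hasSum_ite_eq 0 _).summable) fun z ↦ ?_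
  have hz : z = Circle.exp (2 * ((z : ℂ).arg / 2)) := by
    rw [mul_div_cancel₀ _ two_ne_zero, Circle.exp_arg]
  simp only [sub_mul]
  rw [(summable_pow_natAbs_sq_mul_zpow hq' z).tsum_sub (hdelta z _).summable, (hdelta z _).tsum_eq,
    hz, ← ofReal_theta3Series _ hq', theta3_of_lt_one _ hq1, ← Complex.ofReal_sub,
    Complex.zero_le_real, sub_nonneg]
  exact theta3Series_pi_div_two_le hq.1 hq1 _

/-- When the theta value is `1`, the matrix minus `1` is positive semidefinite with zero diagonal,
so all off-diagonal entries vanish and `h` is the unit at `0`. -/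
theorem exists_posSemidef_circulant (hq : q ∈ Set.Icc (0 : ℝ) 1) :
    ∃ h : ℤ → ℂ, (Matrix.circulant h).PosSemidef ∧ h 0 = 1 ∧
      ∀ d ≠ 0, (1 - theta3 (Real.pi / 2) q : ℝ) * h d = (q : ℂ) ^ (d.natAbs ^ 2) := by
  set θ := theta3 (Real.pi / 2) q
  have hpos := posSemidef_circulant_sub_theta3 hq
  obtain hθ | hθ := (theta3_pi_div_two_mem_Icc hq).2.eq_or_lt
  · refine ⟨Pi.single 0 1, by simpa using Matrix.PosSemidef.one, by simp, fun d hd ↦ ?_⟩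
    have h : ‖(q : ℂ) ^ (d.natAbs ^ 2)‖ ≤ 0 := by
      simpa [Matrix.circulant_apply, hd, hθ, θ] using norm_apply_le_sqrt_mul_sqrt hpos d 0
    rw [norm_le_zero_iff.1 h, Pi.single_eq_of_ne hd, mul_zero]
  · have hne : ((1 - θ : ℝ) : ℂ) ≠ 0 := Complex.ofReal_ne_zero.2 (sub_pos.2 hθ).ne'
    have hinv : 0 ≤ (((1 - θ)⁻¹ : ℝ) : ℂ) :=
      Complex.zero_le_real.2 (inv_nonneg.2 (sub_nonneg.2 hθ.le))
    have hscaled := hpos.smul hinv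
    rw [← Matrix.circulant_smul] at hscaled
    refine ⟨_, hscaled, ?_, fun d hd ↦ ?_⟩
    · simpa [θ] using inv_mul_cancel₀ hne
    · rw [Pi.smul_apply, smul_eq_mul, if_neg hd, sub_zero, Complex.ofReal_inv,
        mul_inv_cancel_left₀ hne]

end Theta

section Beta

variable {N : ℕ} {a : ℝ}

theorem coin_nonneg (N k : ℕ) : 0 ≤ coin N k := by
  unfold coin
  positivity

theorem coin_zero_le {k : ℕ} (hk : k ≤ N) : coin N 0 ≤ coin N k := by
  unfold coin
  gcongr
  rw [Nat.choose_zero_right]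
  exact Nat.choose_pos hk

theorem sum_coin (N : ℕ) : ∑ j : Fin (N + 1), coin N j = 1 := by
  rw [Fin.sum_univ_eq_sum_range (fun k ↦ coin N k)]
  simp only [coin, ← Finset.sum_div]
  rw [div_eq_one_iff_eq (by positivity)]
  exact_mod_cast Nat.sum_range_choose N

theorem coin_mul_one_sub_nonneg (k : ℕ) (ha : a ∈ Set.Icc (0 : ℝ) 1) : 0 ≤ coin N k * (1 - a) :=
  mul_nonneg (coin_nonneg N k) (sub_nonneg.2 ha.2)

theorem u_nonneg (k : ℕ) (ha : a ∈ Set.Icc (0 : ℝ) 1) : 0 ≤ u N k a := by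
  refine sub_nonneg.2 (Real.le_sqrt_of_sq_le ?_)
  linear_combination mul_nonneg (coin_mul_one_sub_nonneg (N := N) k ha) ha.1

theorem u_sq (k : ℕ) (ha : a ∈ Set.Icc (0 : ℝ) 1) :
    u N k a ^ 2 = coin N k * (1 - a) * (a - 2 * u N k a) := by
  have hz := coin_mul_one_sub_nonneg (N := N) k ha
  have hsq := Real.sq_sqrt (mul_nonneg hz (add_nonneg ha.1 hz))
  unfold u
  linear_combination hsq

theorem two_mul_u_le (k : ℕ) (ha : a ∈ Set.Icc (0 : ℝ) 1) : 2 * u N k a ≤ a := by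
  have hz := coin_mul_one_sub_nonneg (N := N) k ha
  have hmean : √(coin N k * (1 - a) * (a + coin N k * (1 - a))) ≤ a / 2 + coin N k * (1 - a) :=
    Real.sqrt_le_iff.2 ⟨add_nonneg (div_nonneg ha.1 zero_le_two) hz, by
      linear_combination sq_nonneg a / 4⟩
  unfold u
  linear_combination 2 * hmean

theorem strictAntiOn_half_one_sub_add_u (N k : ℕ) :
    StrictAntiOn (fun a ↦ (1 - a) / 2 + u N k a) (Set.Icc 0 1) := by
  intro a ha b hb hab
  by_contra! h
  have hlt : u N k a < u N k b := by linarith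
  have hsq : u N k b ^ 2 ≤ u N k a ^ 2 := by
    rw [u_sq k ha, u_sq k hb]
    refine mul_le_mul ?_ (by linarith) (sub_nonneg.2 (two_mul_u_le k hb))
      (coin_mul_one_sub_nonneg k ha)
    have := coin_nonneg N k
    gcongr
  exact hsq.not_gt (pow_lt_pow_left₀ hlt (u_nonneg k ha) two_ne_zero)

theorem strictAntiOn_beta (N k k' : ℕ) : StrictAntiOn (beta N k k') (Set.Icc 0 1) := by
  refine ((strictAntiOn_half_one_sub_add_u N k).add
    (strictAntiOn_half_one_sub_add_u N k')).congr fun a _ ↦ ?_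
  simp only [beta]
  ring

theorem beta_zero (N k k' : ℕ) : beta N k k' 0 = 1 := by
  simp [beta, u, Real.sqrt_mul_self (coin_nonneg N _)]

theorem beta_one (N k k' : ℕ) : beta N k k' 1 = 0 := by
  simp [beta, u]

theorem bijOn_beta (N k k' : ℕ) :
    Set.BijOn (beta N k k') (Set.Icc 0 1) (Set.Icc 0 1) := by
  have hcont : Continuous (beta N k k') := by
    unfold beta u
    fun_prop
  have hanti := strictAntiOn_beta N k k'
  refine ⟨?_, hanti.injOn, ?_⟩
  · simpa only [beta_zero, beta_one] using hanti.antitoneOn.mapsTo_Icc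
  · simpa only [Set.SurjOn, beta_zero, beta_one] using
      intermediate_value_Icc' (zero_le_one' ℝ) hcont.continuousOn

theorem one_sub_le_beta (k k' : ℕ) (ha : a ∈ Set.Icc (0 : ℝ) 1) : 1 - a ≤ beta N k k' a := by
  rw [beta, add_assoc]
  exact le_add_of_nonneg_right (add_nonneg (u_nonneg k ha) (u_nonneg k' ha))

end Beta

section Mixture

open Matrix

variable {N : ℕ} {a t : ℝ}

theorem weight_le (n : QubitLabel N) : weight n ≤ N := by
  calc weight n ≤ ∑ _l : Fin N, 1 := Finset.sum_le_sum fun l _ ↦ by omega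
    _ = N := by simp

theorem weight_eq_card (n : QubitLabel N) : weight n = (Finset.univ.filter (n · = 1)).card := by
  rw [weight, Finset.card_filter]
  refine Finset.sum_congr rfl fun l _ ↦ ?_
  obtain h | h := Fin.exists_fin_two.1 ⟨n l, rfl⟩ <;> simp [h]

theorem card_filter_weight_eq (N k : ℕ) :
    (Finset.univ.filter fun n : QubitLabel N ↦ weight n = k).card = N.choose k := by
  conv_rhs => rw [← Finset.card_fin N, ← Finset.card_powersetCard]
  refine Finset.card_nbij' (fun n ↦ Finset.univ.filter (n · = 1))
    (fun s l ↦ if l ∈ s then 1 else 0) (fun n hn ↦ ?_) (fun s hs ↦ ?_) (fun n _ ↦ ?_)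
    (fun s _ ↦ ?_)
  · simpa [weight_eq_card] using hn
  · simpa [weight_eq_card] using hs
  · ext l
    obtain h | h := Fin.exists_fin_two.1 ⟨n l, rfl⟩ <;> simp [h]
  · ext l
    simp

theorem mixedObservable_eq_diagonal (N : ℕ) (a : ℝ) (j : Fin (N + 1)) :
    mixedObservable N a j = diagonal fun n ↦
      ((coin N j * (1 - a) + if weight n = j then a else 0 : ℝ) : ℂ) := by
  have htrace : (spectralObservable N j).trace = (N.choose j : ℂ) := by
    rw [spectralObservable, trace_diagonal, Finset.sum_boole, card_filter_weight_eq]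
  rw [mixedObservable, depolarisedObservable, htrace, spectralObservable, smul_smul,
    smul_one_eq_diagonal, ← diagonal_smul, diagonal_add]
  congr 1 with n
  simp only [coin, Pi.smul_apply, smul_eq_mul]
  split_ifs <;> push_cast <;> ring

theorem sum_fin_ite_eq {M : Type*} [AddCommMonoid M] {k : ℕ} (hk : k ≤ N) (x : M) :
    ∑ j : Fin (N + 1), (if k = j then x else 0) = x := by
  obtain ⟨i, rfl⟩ : ∃ i : Fin (N + 1), (i : ℕ) = k := ⟨⟨k, Nat.lt_succ_of_le hk⟩, rfl⟩
  simp [Fin.val_inj]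

theorem isObservable_mixedObservable (ha : a ∈ Set.Icc (0 : ℝ) 1) :
    IsObservable (mixedObservable N a) := by
  refine ⟨fun j ↦ ?_, ?_⟩
  · rw [mixedObservable_eq_diagonal]
    refine .diagonal fun n ↦ Complex.zero_le_real.2 (add_nonneg (coin_mul_one_sub_nonneg j ha) ?_)
    split_ifs
    exacts [ha.1, le_rfl]
  · have hentry (n : QubitLabel N) :
        ∑ j : Fin (N + 1), (coin N j * (1 - a) + if weight n = j then a else 0) = 1 := by
      rw [Finset.sum_add_distrib, ← Finset.sum_mul, sum_coin, sum_fin_ite_eq (weight_le n), one_mul,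
        sub_add_cancel]
    ext n m
    obtain rfl | hnm := eq_or_ne n m
    · simp only [mixedObservable_eq_diagonal, Matrix.sum_apply, diagonal_apply_eq, one_apply_eq,
        ← Complex.ofReal_sum, hentry, Complex.ofReal_one]
    · simp [mixedObservable_eq_diagonal, Matrix.sum_apply, hnm]

theorem isClosed_compatibleMixing (N : ℕ) (t : ℝ) : IsClosed (compatibleMixing N t) := by
  have hcont : Continuous (mixedObservable N) := by
    unfold mixedObservable
    fun_prop
  exact isClosed_Icc.inter ((isClosed_compatibleSet _ _).preimage hcont)

/-- A matrix with the diagonal of `mixedObservable N a j` and constant entries on the blocks of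
labels with weight `j` and of labels with weight different from `j`. Its coherences are chosen as
large as positivity of the `2 × 2` matrix of block values permits for `j = 0`. -/
noncomputable def coherentLift (N : ℕ) (a : ℝ) (j : Fin (N + 1)) :
    Matrix (QubitLabel N) (QubitLabel N) ℂ :=
  of fun n m ↦ ((coin N j * (1 - a) + (if weight n = j then u N 0 a else 0) +
    (if weight m = j then u N 0 a else 0) +
      if weight n = j ∧ weight m = j then a - 2 * u N 0 a else 0 : ℝ) : ℂ)

theorem coherentLift_apply_self (N : ℕ) (a : ℝ) (j : Fin (N + 1)) (n : QubitLabel N) :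
    coherentLift N a j n n = mixedObservable N a j n n := by
  rw [coherentLift, of_apply, mixedObservable_eq_diagonal, diagonal_apply_eq]
  simp only [and_self]
  congr 1
  split_ifs <;> ring

theorem add_u_sq_le (ha : a ∈ Set.Icc (0 : ℝ) 1) {j : ℕ} (hj : j ≤ N) :
    (coin N j * (1 - a) + u N 0 a) ^ 2 ≤ coin N j * (1 - a) * (coin N j * (1 - a) + a) := by
  have hu : u N 0 a ^ 2 ≤ coin N j * (1 - a) * (a - 2 * u N 0 a) := by
    have := coin_zero_le hj
    have := sub_nonneg.2 ha.2
    have := sub_nonneg.2 (two_mul_u_le (N := N) 0 ha)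
    rw [u_sq 0 ha]
    gcongr
  linear_combination hu

theorem posSemidef_coherentLift (ha : a ∈ Set.Icc (0 : ℝ) 1) (j : Fin (N + 1)) :
    (coherentLift N a j).PosSemidef := by
  have hz := coin_mul_one_sub_nonneg (N := N) j ha
  let block : Matrix (Fin 2) (Fin 2) ℂ :=
    !![((coin N j * (1 - a) : ℝ) : ℂ), ((coin N j * (1 - a) + u N 0 a : ℝ) : ℂ);
      star ((coin N j * (1 - a) + u N 0 a : ℝ) : ℂ), ((coin N j * (1 - a) + a : ℝ) : ℂ)]
  have hblock : block.PosSemidef := posSemidef_fin_two hz (add_nonneg hz ha.1) <| by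
    rw [Complex.norm_real, Real.norm_eq_abs, sq_abs]
    exact add_u_sq_le ha j.is_le
  have hlift : coherentLift N a j = block.submatrix
      (fun n ↦ if weight n = j then 1 else 0) fun n ↦ if weight n = j then 1 else 0 := by
    ext n m
    rw [coherentLift, of_apply, submatrix_apply]
    by_cases hn : weight n = j <;> by_cases hm : weight m = j <;> simp [block, hn, hm]
    ring
  rw [hlift]
  exact hblock.submatrix _

theorem sum_coherentLift_apply (a : ℝ) (n m : QubitLabel N) :
    ∑ j, coherentLift N a j n m = if weight n = weight m then 1 else (beta N 0 0 a : ℂ) := by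
  simp only [coherentLift, of_apply, ← Complex.ofReal_sum, Finset.sum_add_distrib, ← Finset.sum_mul,
    sum_coin, sum_fin_ite_eq (weight_le _)]
  split_ifs with hnm
  · simp only [hnm, and_self, sum_fin_ite_eq (weight_le _)]
    push_cast
    ring
  · have hzero (j : Fin (N + 1)) : ¬(weight n = j ∧ weight m = j) := fun h ↦
      hnm (h.1.trans h.2.symm)
    simp only [hzero, if_false, Finset.sum_const_zero, beta]
    push_cast
    ring

theorem mem_compatibleMixing_of_posSemidef_circulant (ha : a ∈ Set.Icc (0 : ℝ) 1) {h : ℤ → ℂ}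
    (hpos : (circulant h).PosSemidef) (h0 : h 0 = 1)
    (hne : ∀ d ≠ 0, beta N 0 0 a * h d = (t : ℂ) ^ (d.natAbs ^ 2)) :
    a ∈ compatibleMixing N t := by
  set H := (circulant h).submatrix (fun n : QubitLabel N ↦ (weight n : ℤ)) fun n ↦ (weight n : ℤ)
  refine ⟨ha, mem_compatibleSet_of_decomposition (isObservable_mixedObservable ha)
    (fun j ↦ coherentLift N a j ⊙ H)
    (fun j ↦ (posSemidef_coherentLift ha j).hadamard (hpos.submatrix _)) ?_ fun j ↦ ?_⟩
  · ext n m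
    simp only [Matrix.sum_apply, hadamard_apply, ← Finset.sum_mul, sum_coherentLift_apply]
    split_ifs with hnm
    · simp [H, coherenceMatrix, hnm, h0]
    · simpa [H, coherenceMatrix] using hne _ (sub_ne_zero.2 (Nat.cast_injective.ne hnm))
  · ext n m
    obtain rfl | hnm := eq_or_ne n m
    · simp [H, h0, coherentLift_apply_self]
    · simp [hnm, mixedObservable_eq_diagonal]

theorem mem_compatibleMixing_of_beta_eq (ht : t ∈ Set.Icc (0 : ℝ) 1)
    (ha : a ∈ Set.Icc (0 : ℝ) 1) (hb : beta N 0 0 a = 1 - theta3 (Real.pi / 2) t) :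
    a ∈ compatibleMixing N t := by
  obtain ⟨h, hpos, h0, hne⟩ := exists_posSemidef_circulant ht
  exact mem_compatibleMixing_of_posSemidef_circulant ha hpos h0 (by rwa [hb])

theorem sqrt_re_mul_sqrt_re_mixedObservable (ha : a ∈ Set.Icc (0 : ℝ) 1) {n m : QubitLabel N}
    (hnm : weight n ≠ weight m) (j : Fin (N + 1)) :
    √(mixedObservable N a j n n).re * √(mixedObservable N a j m m).re = coin N j * (1 - a) +
      (if weight n = j then u N (weight n) a else 0) +
        if weight m = j then u N (weight m) a else 0 := by
  have hz := coin_mul_one_sub_nonneg (N := N) j ha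
  have hsqrt : √(coin N j * (1 - a) + a) * √(coin N j * (1 - a)) =
      coin N j * (1 - a) + u N j a := by
    rw [mul_comm, ← Real.sqrt_mul hz, u, add_sub_cancel, add_comm a]
  simp only [mixedObservable_eq_diagonal, diagonal_apply_eq, Complex.ofReal_re]
  by_cases hn : weight n = j
  · have hm : weight m ≠ j := hn ▸ hnm.symm
    simp only [hn, hm, if_true, if_false, add_zero, hsqrt]
  by_cases hm : weight m = j
  · simp only [hn, hm, if_true, if_false, add_zero, mul_comm √(coin N j * (1 - a)), hsqrt]
  · simp only [hn, hm, if_false, add_zero, Real.mul_self_sqrt hz]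

theorem pow_le_beta_of_mem_compatibleMixing (ht : 0 ≤ t) (h : a ∈ compatibleMixing N t)
    {n m : QubitLabel N} (hnm : weight n ≠ weight m) :
    t ^ (((weight n : ℤ) - weight m).natAbs ^ 2) ≤ beta N (weight n) (weight m) a := by
  have hle := norm_apply_le_of_mem_compatibleSet h.2 fun e : n = m ↦ hnm (congrArg weight e)
  simp only [sqrt_re_mul_sqrt_re_mixedObservable h.1 hnm, Finset.sum_add_distrib, ← Finset.sum_mul,
    sum_coin, sum_fin_ite_eq (weight_le _), one_mul] at hle
  rwa [coherenceMatrix, of_apply, Complex.norm_of_nonneg (pow_nonneg ht _)] at hle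

theorem le_beta_of_mem_compatibleMixing (hN : 1 ≤ N) (ht : 0 ≤ t)
    (h : a ∈ compatibleMixing N t) : t ≤ beta N 0 1 a := by
  have hzero : weight (0 : QubitLabel N) = 0 := by simp [weight]
  have hone : weight (Pi.single ⟨0, hN⟩ 1 : QubitLabel N) = 1 := by
    simp [weight, Pi.single_apply, apply_ite]
  simpa [hzero, hone] using pow_le_beta_of_mem_compatibleMixing ht h
    (n := 0) (m := Pi.single ⟨0, hN⟩ 1) (by simp [hzero, hone])

end Mixture

section CriticalMixing

variable {N : ℕ} {t : ℝ}

theorem one_sub_theta3_mem_Icc (ht : t ∈ Set.Icc (0 : ℝ) 1) :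
    1 - theta3 (Real.pi / 2) t ∈ Set.Icc (0 : ℝ) 1 :=
  Set.Icc.one_sub_mem (theta3_pi_div_two_mem_Icc ht)

theorem lowerBound_mem_Icc (ht : t ∈ Set.Icc (0 : ℝ) 1) : lowerBound N t ∈ Set.Icc (0 : ℝ) 1 :=
  Function.invFunOn_mem ((bijOn_beta N 0 0).surjOn (one_sub_theta3_mem_Icc ht))

theorem beta_lowerBound (ht : t ∈ Set.Icc (0 : ℝ) 1) :
    beta N 0 0 (lowerBound N t) = 1 - theta3 (Real.pi / 2) t :=
  Function.invFunOn_eq ((bijOn_beta N 0 0).surjOn (one_sub_theta3_mem_Icc ht))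

theorem upperBound_mem_Icc (ht : t ∈ Set.Icc (0 : ℝ) 1) : upperBound N t ∈ Set.Icc (0 : ℝ) 1 :=
  Function.invFunOn_mem ((bijOn_beta N 0 1).surjOn ht)

theorem beta_upperBound (ht : t ∈ Set.Icc (0 : ℝ) 1) : beta N 0 1 (upperBound N t) = t :=
  Function.invFunOn_eq ((bijOn_beta N 0 1).surjOn ht)

theorem theta3_le_lowerBound (ht : t ∈ Set.Icc (0 : ℝ) 1) :
    theta3 (Real.pi / 2) t ≤ lowerBound N t := by
  have hθ := theta3_pi_div_two_mem_Icc ht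
  rw [← (strictAntiOn_beta N 0 0).le_iff_ge (lowerBound_mem_Icc ht) hθ, beta_lowerBound ht]
  exact one_sub_le_beta 0 0 hθ

theorem lowerBound_mem_compatibleMixing (ht : t ∈ Set.Icc (0 : ℝ) 1) :
    lowerBound N t ∈ compatibleMixing N t :=
  mem_compatibleMixing_of_beta_eq ht (lowerBound_mem_Icc ht) (beta_lowerBound ht)

theorem le_upperBound_of_mem_compatibleMixing (hN : 1 ≤ N) (ht : t ∈ Set.Icc (0 : ℝ) 1) {a : ℝ}
    (h : a ∈ compatibleMixing N t) : a ≤ upperBound N t := by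
  rw [← (strictAntiOn_beta N 0 1).le_iff_ge (upperBound_mem_Icc ht) h.1, beta_upperBound ht]
  exact le_beta_of_mem_compatibleMixing hN ht.1 h

theorem isGreatest_critical (h : (compatibleMixing N t).Nonempty) :
    IsGreatest (compatibleMixing N t) (critical N t) := by
  have hbdd : BddAbove (compatibleMixing N t) := ⟨1, fun a ha ↦ ha.1.2⟩
  exact ⟨(isClosed_compatibleMixing N t).csSup_mem h hbdd, fun a ha ↦ le_csSup hbdd ha⟩

end CriticalMixing

end SpinBoson

theorem proposition4 (N : ℕ) (hN : 1 ≤ N) :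
    -- the inverse functions and the value of the theta function at `1` are well defined
    (StrictAntiOn (SpinBoson.beta N 0 1) (Set.Icc 0 1) ∧
      Set.BijOn (SpinBoson.beta N 0 1) (Set.Icc 0 1) (Set.Icc 0 1)) ∧
    (StrictAntiOn (SpinBoson.beta N 0 0) (Set.Icc 0 1) ∧
      Set.BijOn (SpinBoson.beta N 0 0) (Set.Icc 0 1) (Set.Icc 0 1)) ∧
    Filter.Tendsto (SpinBoson.theta3Series (Real.pi / 2)) (nhdsWithin 1 (Set.Iio 1))
      (nhds (SpinBoson.theta3 (Real.pi / 2) 1)) ∧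
    ∀ t : ℝ, t ∈ Set.Icc (0 : ℝ) 1 →
      SpinBoson.theta3 (Real.pi / 2) t ∈ Set.Icc (0 : ℝ) 1 ∧
      -- the critical parameter is an attained maximum
      IsGreatest (SpinBoson.compatibleMixing N t) (SpinBoson.critical N t) ∧
      -- the chain of bounds
      SpinBoson.theta3 (Real.pi / 2) t ≤ SpinBoson.lowerBound N t ∧
      SpinBoson.lowerBound N t ≤ SpinBoson.critical N t ∧
      SpinBoson.critical N t ≤ SpinBoson.upperBound N t := by
  open SpinBoson in
  refine ⟨⟨strictAntiOn_beta N 0 1, bijOn_beta N 0 1⟩,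
    ⟨strictAntiOn_beta N 0 0, bijOn_beta N 0 0⟩,
    theta3_pi_div_two_one ▸ tendsto_theta3Series_pi_div_two, fun t ht ↦ ?_⟩
  have hlower := lowerBound_mem_compatibleMixing (N := N) ht
  have hmax := isGreatest_critical ⟨_, hlower⟩
  exact ⟨theta3_pi_div_two_mem_Icc ht, hmax, theta3_le_lowerBound ht, hmax.2 hlower,
    le_upperBound_of_mem_compatibleMixing hN ht hmax.1⟩
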